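/- Let $\mathsf{SG}$ be the doubly-infinite Sierpinski gasket graph: let $G_0$ be the complete graph on the vertices $(0,0),(1,0),(0,1)$ of $\mathbb{Z}^2$, let $G_{k+1}$ be the union of the translates of $G_k$ by $(0,0)$, $(2^k,0)$ and $(0,2^k)$, and put $\mathsf{SG}^+=\bigcup_{k\ge 0}G_k$ and $\mathsf{SG}=\mathsf{SG}^+\cup(-\mathsf{SG}^+)$. Write $o=(0,0)$. For an integer $n$ let $B_n$ be the set of vertices at graph distance at most $n$ from $o$ (so $B_n=\emptyset$ for $n<0$), let $\partial B_n=\{u\in B_n:\ \exists v\notin B_n,\ v\sim u\}$, and let $b_n=|B_n|-\tfrac12|\partial B_n|$. For a function $f$ on the vertices of $\mathsf{SG}$ let $\Delta f(x)=\tfrac14\sum_{y\sim x}f(y)-f(x)$. In the divisible sandpile, toppling a vertex $x$ turns the sand distribution $\mu$ into $T_x\mu=\mu+\max\{\mu(x)-1,0\}\,\Delta\delta_x$. Given an initial distribution $\mu_0$ and a toppling sequence $(x_k)_{k\ge1}$, that is, a sequence that contains each vertex infinitely often, put $\mu_k=T_{x_k}\mu_{k-1}$ and let $u_k(y)=\sum_{j\le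 k:\,x_j=y}\bigl(\mu_{j-1}(y)-\mu_j(y)\bigr)$ be the mass emitted from $y$ during the first $k$ topplings. The pointwise limits of $\mu_k$ and of $u_k$, when they exist and do not depend on the toppling sequence, are the limit sand distribution and the odometer function $u$; the sandpile cluster is $\{z: u(z)>0\}$. **Theorem.** For every integer $n$, the divisible sandpile on $\mathsf{SG}$ with initial distribution $b_n\delta_o$ has a limit sand distribution $\mu$ and an odometer function (for every toppling sequence, with limits independent of the sequence), and $$\mu(z)=\begin{cases}1 & \text{if } z\in B_n\setminus\partial B_n,\\ \tfrac12 & \text{if } z\in\partial B_n,\\ 0 & \text{if } z\notin B_n.\end{cases}$$ The corresponding sandpile cluster is exactly $B_{n-1}$. -/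

import Mathlib

open Filter Topology

noncomputable section

namespace GasketSandpile

/-- Translation of the lattice by `a`, as an endomorphism of the complete graph on `ℤ × ℤ`. -/
def shift (a : ℤ × ℤ) : (⊤ : SimpleGraph (ℤ × ℤ)) →g (⊤ : SimpleGraph (ℤ × ℤ)) where
  toFun p := p + a
  map_rel' := by
    intro p q h
    simpa using h

/-- The reflection `p ↦ -p` of the lattice, as an endomorphism of the complete graph. -/
def reflect : (⊤ : SimpleGraph (ℤ × ℤ)) →g (⊤ : SimpleGraph (ℤ × ℤ)) where
  toFun p := -p
  map_rel' := by
    intro p q h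
    simpa using h

/-- The finite graphs `G_k`: `G_0` is the complete graph on `(0,0), (1,0), (0,1)`, and `G_{k+1}` is
the union of the translates of `G_k` by `(0,0)`, `(2^k,0)` and `(0,2^k)`. A graph whose vertices
are lattice points is a subgraph of the complete graph on `ℤ × ℤ`. -/
def level : ℕ → (⊤ : SimpleGraph (ℤ × ℤ)).Subgraph
  | 0 => (⊤ : (⊤ : SimpleGraph (ℤ × ℤ)).Subgraph).induce {(0, 0), (1, 0), (0, 1)}
  | k + 1 =>
      (level k).map (shift (0, 0)) ⊔ (level k).map (shift (2 ^ k, 0)) ⊔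
        (level k).map (shift (0, 2 ^ k))

/-- The one-sided Sierpinski gasket graph. -/
def gasketPos : (⊤ : SimpleGraph (ℤ × ℤ)).Subgraph := ⨆ k, level k

/-- The double-sided Sierpinski gasket graph, with its vertices as a set of lattice points. -/
def gasket : (⊤ : SimpleGraph (ℤ × ℤ)).Subgraph := gasketPos ⊔ gasketPos.map reflect

/-- The vertices of the double-sided Sierpinski gasket graph. -/
abbrev Vertex : Type := gasket.verts

/-- The double-sided Sierpinski gasket graph, on its own vertex type. -/
def SG : SimpleGraph Vertex := gasket.coe

theorem origin_mem : ((0, 0) : ℤ × ℤ) ∈ gasket.verts := by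
  have h : ((0, 0) : ℤ × ℤ) ∈ gasketPos.verts := by
    rw [gasketPos, SimpleGraph.Subgraph.verts_iSup]
    exact Set.mem_iUnion.2 ⟨0, by simp [level]⟩
  rw [gasket, SimpleGraph.Subgraph.verts_sup]
  exact Or.inl h

/-- The origin `o = (0,0)`. -/
def origin : Vertex := ⟨(0, 0), origin_mem⟩

/-- The ball `B_n` around the origin in the graph metric; it is empty for negative `n`. -/
def ball (n : ℤ) : Set Vertex := {z | (SG.dist origin z : ℤ) ≤ n}

/-- The inner boundary `∂A`. -/
def innerBoundary (A : Set Vertex) : Set Vertex := {u | u ∈ A ∧ ∃ v, v ∉ A ∧ SG.Adj u v}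

/-- `b_n = |B_n| - (1/2) |∂B_n|`. -/
def ballMass (n : ℤ) : ℝ := (ball n).ncard - 1 / 2 * (innerBoundary (ball n)).ncard

/-- The Laplacian `Δf(x) = (1/4) ∑_{y ∼ x} f(y) - f(x)`. -/
def laplacian (f : Vertex → ℝ) (x : Vertex) : ℝ :=
  1 / 4 * (∑ᶠ y ∈ SG.neighborSet x, f y) - f x

/-- The unit mass `δ_x`. -/
def pointMass (x : Vertex) : Vertex → ℝ := Pi.single x 1

/-- The toppling operator `T_x μ = μ + max {μ(x) - 1, 0} Δδ_x`, for the height function `h ≡ 1`. -/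
def topple (x : Vertex) (μ : Vertex → ℝ) : Vertex → ℝ :=
  fun y => μ y + max (μ x - 1) 0 * laplacian (pointMass x) y

/-- The sand distribution after `k` topplings; the `(k+1)`-st toppling is at the vertex `x k`. -/
def sand (μ₀ : Vertex → ℝ) (x : ℕ → Vertex) : ℕ → Vertex → ℝ
  | 0 => μ₀
  | k + 1 => topple (x k) (sand μ₀ x k)

/-- The mass emitted from `y` during the first `k` topplings. -/
def emitted (μ₀ : Vertex → ℝ) (x : ℕ → Vertex) (k : ℕ) (y : Vertex) : ℝ :=
  ∑ j ∈ Finset.range k with x j = y, (sand μ₀ x j y - sand μ₀ x (j + 1) y)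

/-- A toppling sequence contains each vertex infinitely often. -/
def IsTopplingSequence (x : ℕ → Vertex) : Prop := ∀ z, ∃ᶠ k in atTop, x k = z

/-- `μ` is the limit sand distribution of the divisible sandpile started from `μ₀`: for every
toppling sequence the sand distributions converge pointwise to `μ`. -/
def IsLimitSand (μ₀ μ : Vertex → ℝ) : Prop :=
  ∀ x, IsTopplingSequence x → ∀ z, Tendsto (fun k => sand μ₀ x k z) atTop (𝓝 (μ z))

/-- `u` is the odometer function of the divisible sandpile started from `μ₀`: for every toppling
sequence the emitted masses converge pointwise to `u`. -/
def IsOdometer (μ₀ u : Vertex → ℝ) : Prop :=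
  ∀ x, IsTopplingSequence x → ∀ z, Tendsto (fun k => emitted μ₀ x k z) atTop (𝓝 (u z))

/-- The sandpile cluster belonging to the odometer function `u`. -/
def cluster (u : Vertex → ℝ) : Set Vertex := {z | 0 < u z}

open Classical in
/-- The sand distribution equal to `1` on `B_n ∖ ∂B_n`, to `1/2` on `∂B_n`, and to `0` elsewhere. -/
def finalSand (n : ℤ) (z : Vertex) : ℝ :=
  if z ∈ ball n then (if z ∈ innerBoundary (ball n) then 1 / 2 else 1) else 0

end GasketSandpile

end

/-!
The network `SG` is made of triangles, and its Laplacian is a sum over triangles. If every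
triangle of `B_n` brings mass `1/2` to each of its corners, a vertex of `B_n` receives `1` or, on
`∂B_n`, `1/2`, because each vertex lies in two triangles, one of which is missing on `∂B_n`. The
odometer is therefore a function with this source that is supported on `B_{n-1}`, positive there,
and harmonic except for a point sink at the origin. It is assembled by recursion over the graphs
`G_k`: a ball that reaches beyond `G_k` restricts to smaller balls in the two outer copies of
`G_k` in `G_{k+1}`, and the mass needed at the two junctions is carried from the origin by a
harmonic function on the inner copy, whose boundary flux is known because harmonic extension
multiplies energy by `3/5` per level.

Such a function is the odometer of every toppling sequence. By induction along the sequence the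
emitted masses stay below it (least action), so they increase to a limit; the difference of the
two is subharmonic where it is positive, so it vanishes by the maximum principle.
-/

namespace GasketSandpile

/-! ### Locally finite graphs -/

section Graph

variable {V : Type*} {G : SimpleGraph V}

theorem exists_walk_length_eq_of_descent {o : V} {f : V → ℕ} (hfo : f o = 0)
    (hdesc : ∀ x, x ≠ o → ∃ y, G.Adj x y ∧ f y + 1 = f x) (z : V) :
    ∃ w : G.Walk o z, w.length = f z := by
  induction hN : f z generalizing z with
  | zero =>
    obtain rfl : z = o := by
      by_contra hz
      obtain ⟨y, -, hy⟩ := hdesc z hz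
      lia
    exact ⟨.nil, rfl⟩
  | succ N ih =>
    obtain ⟨y, hzy, hy⟩ := hdesc z (by rintro rfl; lia)
    obtain ⟨w, hw⟩ := ih y (by lia)
    exact ⟨w.concat hzy.symm, by rw [SimpleGraph.Walk.length_concat, hw]⟩

theorem le_add_walk_length {f : V → ℕ} (hlip : ∀ ⦃x y⦄, G.Adj x y → f y ≤ f x + 1) {x y : V}
    (w : G.Walk x y) : f y ≤ f x + w.length := by
  induction w with
  | nil => simp
  | cons hxy w ih =>
    have := hlip hxy
    rw [SimpleGraph.Walk.length_cons]
    lia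

theorem dist_eq_of_descent {o : V} {f : V → ℕ} (hfo : f o = 0)
    (hlip : ∀ ⦃x y⦄, G.Adj x y → f y ≤ f x + 1)
    (hdesc : ∀ x, x ≠ o → ∃ y, G.Adj x y ∧ f y + 1 = f x) (z : V) : G.dist o z = f z := by
  obtain ⟨w, hw⟩ := exists_walk_length_eq_of_descent hfo hdesc z
  obtain ⟨v, hv⟩ := w.reachable.exists_walk_length_eq_dist
  have := le_add_walk_length hlip v
  have := SimpleGraph.dist_le w
  lia

theorem sum_sum_neighborFinset_sub_eq_zero [G.LocallyFinite] {R : Type*} [AddCommGroup R]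
    {S : Finset V} {u : V → R} (hu : ∀ z ∈ S, ∀ y ∉ S, G.Adj z y → u y = u z) :
    ∑ z ∈ S, ∑ y ∈ G.neighborFinset z, (u y - u z) = 0 := by
  classical
  have hinner : ∀ z ∈ S, ∑ y ∈ G.neighborFinset z, (u y - u z) =
      ∑ y ∈ S with G.Adj z y, (u y - u z) := by
    refine fun z hz => (Finset.sum_subset (by intro y; simp) fun y hy hyS => ?_).symm
    rw [SimpleGraph.mem_neighborFinset] at hy
    exact sub_eq_zero.2 (hu z hz y (fun h => hyS (Finset.mem_filter.2 ⟨h, hy⟩)) hy)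
  rw [Finset.sum_congr rfl hinner]
  simp only [Finset.sum_sub_distrib]
  refine sub_eq_zero.2 (Finset.sum_comm' fun z y => ?_)
  simp only [Finset.mem_filter, G.adj_comm z y]
  tauto

theorem nonpos_of_subharmonic [G.LocallyFinite] (hG : G.Preconnected) {R : Type*} [AddCommGroup R]
    [LinearOrder R] [IsOrderedAddMonoid R] {w : V → R} (hfin : {z | 0 < w z}.Finite)
    (hsub : ∀ z, 0 < w z → 0 ≤ ∑ y ∈ G.neighborFinset z, (w y - w z)) (hw : ∃ z, w z ≤ 0)
    (z : V) : w z ≤ 0 := by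
  by_contra! hz
  obtain ⟨m, hm, hmax⟩ := Set.exists_max_image _ w hfin ⟨z, hz⟩
  have hle (y : V) : w y ≤ w m := (le_or_gt (w y) 0).elim (·.trans hm.le) (hmax y)
  have hstep : ∀ ⦃x y⦄, G.Adj x y → w x = w m → w y = w m := by
    intro x y hxy hx
    have hterm : ∀ v ∈ G.neighborFinset x, w v - w x ≤ 0 := fun v _ => by
      rw [hx]; exact sub_nonpos.2 (hle v)
    have hsum := (Finset.sum_nonpos hterm).antisymm (hsub x (hx ▸ hm))
    have hzero := (Finset.sum_eq_zero_iff_of_nonpos hterm).1 hsum y (by simpa using hxy)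
    rw [sub_eq_zero.1 hzero, hx]
  obtain ⟨x, hx⟩ := hw
  obtain ⟨p⟩ := hG m x
  have hwalk : ∀ {a b : V}, G.Walk a b → w a = w m → w b = w m := by
    intro a b p
    induction p with
    | nil => exact id
    | cons hab _ ih => exact fun ha => ih (hstep hab ha)
  exact absurd hm (not_lt.2 (hwalk p rfl ▸ hx))

end Graph

/-! ### Triangles of the one-sided gasket -/

/-- The corners of the unit triangle with lower-left corner `0`. Indexing them by `Fin 3` lets
the copies of `G_k` in `G_{k+1}` be treated uniformly: their offsets are `2 ^ k • corner i`. -/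
def corner : Fin 3 → ℤ × ℤ := ![0, (1, 0), (0, 1)]

/-- The height `p.1 + p.2` of a lattice point. On the gasket its absolute value is the distance to
the origin. -/
def height : ℤ × ℤ →+ ℤ := AddMonoidHom.fst ℤ ℤ + AddMonoidHom.snd ℤ ℤ

theorem height_apply (p : ℤ × ℤ) : height p = p.1 + p.2 := rfl

theorem corner_injective : Function.Injective corner := by decide

theorem corner_nonneg (i : Fin 3) : 0 ≤ corner i := by
  revert i; decide

theorem height_corner (i : Fin 3) : height (corner i) = if i = 0 then 0 else 1 := by
  revert i; decide

theorem height_zsmul_corner (m : ℤ) (i : Fin 3) :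
    height (m • corner i) = if i = 0 then 0 else m := by
  rw [map_zsmul, height_corner]
  split_ifs <;> simp

theorem height_nonneg {p : ℤ × ℤ} (hp : 0 ≤ p) : 0 ≤ height p := add_nonneg hp.1 hp.2

/-- The lower-left corners of the unit triangles of `G_k`. -/
def cells : ℕ → Finset (ℤ × ℤ)
  | 0 => {0}
  | k + 1 => Finset.univ.biUnion fun i => (cells k).image (· + (2 ^ k : ℤ) • corner i)

theorem mem_cells_succ {k : ℕ} {t : ℤ × ℤ} :
    t ∈ cells (k + 1) ↔ ∃ i, t - (2 ^ k : ℤ) • corner i ∈ cells k := by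
  simp only [cells, Finset.mem_biUnion, Finset.mem_univ, true_and, Finset.mem_image,
    ← eq_sub_iff_add_eq, exists_eq_right]

theorem cells_subset_succ (k : ℕ) : cells k ⊆ cells (k + 1) := fun t ht =>
  mem_cells_succ.2 ⟨0, by simpa [corner] using ht⟩

theorem nonneg_and_height_lt {k : ℕ} {t : ℤ × ℤ} (ht : t ∈ cells k) :
    0 ≤ t ∧ height t < 2 ^ k := by
  induction k generalizing t with
  | zero => simp_all [cells]
  | succ k ih =>
    obtain ⟨i, hi⟩ := mem_cells_succ.1 ht
    have hpow : (0 : ℤ) < 2 ^ k := by positivity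
    have hnonneg : 0 ≤ (2 ^ k : ℤ) • corner i := smul_nonneg hpow.le (corner_nonneg i)
    have hheight : height ((2 ^ k : ℤ) • corner i) ≤ 2 ^ k := by
      rw [height_zsmul_corner]; split_ifs <;> lia
    obtain ⟨h₁, h₂⟩ := ih hi
    rw [map_sub] at h₂
    exact ⟨hnonneg.trans (sub_nonneg.1 h₁), by rw [pow_succ]; lia⟩

theorem mem_cells_of_mem_succ {k : ℕ} {t : ℤ × ℤ} (ht : t ∈ cells (k + 1))
    (hlt : height t < 2 ^ k) : t ∈ cells k := by
  obtain ⟨i, hi⟩ := mem_cells_succ.1 ht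
  obtain rfl : i = 0 := by
    by_contra hne
    have := height_nonneg (nonneg_and_height_lt hi).1
    rw [map_sub, height_zsmul_corner, if_neg hne] at this
    lia
  simpa [corner] using hi

theorem sum_cells_succ {M : Type*} [AddCommMonoid M] (k : ℕ) (g : ℤ × ℤ → M) :
    ∑ t ∈ cells (k + 1), g t = ∑ i, ∑ t ∈ cells k, g (t + (2 ^ k : ℤ) • corner i) := by
  rw [cells, Finset.sum_biUnion]
  · exact Finset.sum_congr rfl fun i _ => Finset.sum_image (by simp)
  · intro i _ j _ hij
    simp only [Function.onFun, Finset.disjoint_left, Finset.mem_image]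
    rintro _ ⟨s, hs, rfl⟩ ⟨r, hr, hrs⟩
    obtain ⟨⟨hs₁, hs₂⟩, hs₃⟩ := nonneg_and_height_lt hs
    obtain ⟨⟨hr₁, hr₂⟩, hr₃⟩ := nonneg_and_height_lt hr
    rw [height_apply] at hs₃ hr₃
    fin_cases i <;> fin_cases j <;> simp_all [corner, Prod.ext_iff] <;> lia

theorem filter_cells_succ_of_le {k : ℕ} {n : ℤ} (hn : n ≤ 2 ^ k) :
    {t ∈ cells (k + 1) | height t < n} = {t ∈ cells k | height t < n} := by
  ext t
  simp only [Finset.mem_filter]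
  exact and_congr_left fun ht =>
    ⟨fun h => mem_cells_of_mem_succ h (ht.trans_le hn), fun h => cells_subset_succ k h⟩

theorem sum_filter_cells_succ_of_lt {M : Type*} [AddCommMonoid M] {k : ℕ} {n : ℤ}
    (hn : 2 ^ k < n) (g : ℤ × ℤ → M) : ∑ t ∈ cells (k + 1) with height t < n, g t =
      ∑ t ∈ cells k with height t < 2 ^ k, g t +
        ∑ i ∈ {1, 2}, ∑ t ∈ cells k with height t < n - 2 ^ k, g (t + (2 ^ k : ℤ) • corner i) := by
  have hfull : {t ∈ cells k | height t < 2 ^ k} = {t ∈ cells k | height t < n} :=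
    Finset.filter_congr fun t ht => by
      have := (nonneg_and_height_lt ht).2
      lia
  have hzero : (2 ^ k : ℤ) • corner 0 = 0 := smul_zero _
  rw [hfull, Finset.sum_pair (by decide), ← add_assoc]
  simp only [Finset.sum_filter, sum_cells_succ, Fin.sum_univ_three, map_add, height_zsmul_corner,
    lt_sub_iff_add_lt, hzero, one_ne_zero, Fin.reduceEq, if_true, if_false, add_zero]

/-- `t` is the lower-left corner of a unit triangle of the one-sided gasket. -/
def IsCell (t : ℤ × ℤ) : Prop := ∃ k, t ∈ cells k

theorem IsCell.nonneg {t : ℤ × ℤ} (ht : IsCell t) : 0 ≤ t :=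
  ht.elim fun _ hk => (nonneg_and_height_lt hk).1

theorem mem_cells_iff {k : ℕ} {t : ℤ × ℤ} : t ∈ cells k ↔ IsCell t ∧ height t < 2 ^ k := by
  refine ⟨fun ht => ⟨⟨k, ht⟩, (nonneg_and_height_lt ht).2⟩, ?_⟩
  rintro ⟨⟨m, hm⟩, hlt⟩
  have hlarge : t ∈ cells (k + m) :=
    monotone_nat_of_le_succ cells_subset_succ (Nat.le_add_left m k) hm
  clear hm
  induction m with
  | zero => exact hlarge
  | succ m ih =>
    refine ih (mem_cells_of_mem_succ hlarge (hlt.trans_le ?_))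
    exact pow_le_pow_right₀ (by norm_num) (Nat.le_add_right k m)

theorem isCell_zero : IsCell 0 := ⟨0, by simp [cells]⟩

theorem isCell_two_pow_zsmul_corner (k : ℕ) (i : Fin 3) : IsCell ((2 ^ k : ℤ) • corner i) :=
  ⟨k + 1, mem_cells_succ.2 ⟨i, by simpa using mem_cells_iff.2 ⟨isCell_zero, by simp⟩⟩⟩

theorem mem_cells_succ_iff_half {k : ℕ} {t : ℤ × ℤ} :
    t ∈ cells (k + 1) ↔ (t.1 / 2, t.2 / 2) ∈ cells k ∧ (2 ∣ t.1 ∨ 2 ∣ t.2) := by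
  induction k generalizing t with
  | zero =>
    rw [mem_cells_succ]
    simp only [cells, pow_zero, corner, one_smul, Finset.mem_singleton, sub_eq_zero, Prod.ext_iff,
      Fin.exists_fin_succ, Fin.isValue, Matrix.cons_val_zero, Prod.fst_zero, Prod.snd_zero,
      Matrix.cons_val_succ, Matrix.cons_val_fin_one, exists_const]
    lia
  | succ k ih =>
    have hhalf (i : Fin 3) : t - (2 ^ (k + 1) : ℤ) • corner i ∈ cells (k + 1) ↔
        (t.1 / 2, t.2 / 2) - (2 ^ k : ℤ) • corner i ∈ cells k ∧ (2 ∣ t.1 ∨ 2 ∣ t.2) := by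
      have hdiv (a c : ℤ) : (a - 2 ^ (k + 1) * c) / 2 = a / 2 - 2 ^ k * c := by
        rw [pow_succ', mul_assoc, Int.sub_mul_ediv_left _ _ two_ne_zero]
      have hdvd (a c : ℤ) : 2 ∣ a - 2 ^ (k + 1) * c ↔ 2 ∣ a := by
        rw [pow_succ', mul_assoc, dvd_sub_left (dvd_mul_right _ _)]
      rw [ih]
      simp only [Prod.sub_def, Prod.smul_fst, Prod.smul_snd, smul_eq_mul, hdiv, hdvd]
    rw [mem_cells_succ, mem_cells_succ (k := k)]
    simp only [hhalf, exists_and_right]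

theorem isCell_iff_half {t : ℤ × ℤ} :
    IsCell t ↔ IsCell (t.1 / 2, t.2 / 2) ∧ (2 ∣ t.1 ∨ 2 ∣ t.2) := by
  constructor
  · rintro ⟨k, hk⟩
    exact (mem_cells_succ_iff_half.1 (cells_subset_succ k hk)).imp_left (⟨k, ·⟩)
  · rintro ⟨⟨k, hk⟩, h⟩
    exact ⟨k + 1, mem_cells_succ_iff_half.2 ⟨hk, h⟩⟩

theorem isCell_two_mul_two_mul {a b : ℤ} : IsCell (2 * a, 2 * b) ↔ IsCell (a, b) := by
  simp [isCell_iff_half (t := (2 * a, _))]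

theorem isCell_two_mul_add_one_two_mul {a b : ℤ} :
    IsCell (2 * a + 1, 2 * b) ↔ IsCell (a, b) := by
  rw [isCell_iff_half, show (2 * a + 1) / 2 = a by lia]
  simp

theorem isCell_two_mul_two_mul_add_one {a b : ℤ} :
    IsCell (2 * a, 2 * b + 1) ↔ IsCell (a, b) := by
  rw [isCell_iff_half, show (2 * b + 1) / 2 = b by lia]
  simp

theorem not_isCell_two_mul_add_one {a b : ℤ} : ¬IsCell (2 * a + 1, 2 * b + 1) := by
  rw [isCell_iff_half]
  rintro ⟨-, h | h⟩ <;> lia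

open Classical in
/-- The positions that a lattice point `p` takes in the triangles of the one-sided gasket that
contain it: `i ∈ cornersAt p` stands for the triangle with lower-left corner `p - corner i`. -/
noncomputable def cornersAt (p : ℤ × ℤ) : Finset (Fin 3) := {i | IsCell (p - corner i)}

theorem mem_cornersAt {p : ℤ × ℤ} {i : Fin 3} : i ∈ cornersAt p ↔ IsCell (p - corner i) := by
  simp [cornersAt]

theorem nonneg_of_mem_cornersAt {p : ℤ × ℤ} {i : Fin 3} (hi : i ∈ cornersAt p) : 0 ≤ p :=
  (corner_nonneg i).trans (sub_nonneg.1 (mem_cornersAt.1 hi).nonneg)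

theorem cornersAt_zero : cornersAt 0 = {0} := by
  ext i
  rw [mem_cornersAt, Finset.mem_singleton]
  refine ⟨fun hi => corner_injective (le_antisymm ?_ (corner_nonneg i)), ?_⟩
  · exact sub_nonneg.1 hi.nonneg
  · rintro rfl
    simpa [corner] using isCell_zero

open Classical in
theorem card_cornersAt (a b : ℤ) : (cornersAt (a, b)).card =
    (if IsCell (a, b) then 1 else 0) + (if IsCell (a - 1, b) then 1 else 0) +
      if IsCell (a, b - 1) then 1 else 0 := by
  rw [cornersAt, Finset.card_filter, Fin.sum_univ_three]
  simp [corner]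

-- Halving reduces the claim for `p` to the half of `p` if both coordinates are even; in the other
-- cases exactly two of the three candidate triangles at `p` halve to one and the same triangle.
theorem card_cornersAt_eq_zero_or_two {p : ℤ × ℤ} (hp : p ≠ 0) :
    (cornersAt p).card = 0 ∨ (cornersAt p).card = 2 := by
  classical
  induction hN : p.1.natAbs + p.2.natAbs using Nat.strong_induction_on generalizing p with
  | _ N ih =>
    obtain ⟨a, b⟩ := p
    have hodd (c : ℤ) : 2 * c - 1 = 2 * (c - 1) + 1 := by ring
    obtain ⟨c, rfl | rfl⟩ := a.even_or_odd' <;> obtain ⟨d, rfl | rfl⟩ := b.even_or_odd'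
    · simp only [ne_eq, Prod.mk_eq_zero, not_and_or] at hp
      have hhalf := ih _ (by lia) (p := (c, d)) (by simp only [ne_eq, Prod.mk_eq_zero]; lia) rfl
      rw [card_cornersAt] at hhalf ⊢
      simpa only [hodd, isCell_two_mul_two_mul, isCell_two_mul_add_one_two_mul,
        isCell_two_mul_two_mul_add_one] using hhalf
    all_goals
      rw [card_cornersAt]
      simp only [hodd, add_sub_cancel_right, isCell_two_mul_two_mul,
        isCell_two_mul_add_one_two_mul, isCell_two_mul_two_mul_add_one,
        not_isCell_two_mul_add_one, if_false]
      by_cases h : IsCell (c, d) <;> simp [h]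

/-! ### Edges and distances in the gasket -/

theorem level_succ (k : ℕ) :
    level (k + 1) = ⨆ i, (level k).map (shift ((2 ^ k : ℤ) • corner i)) := by
  have h₀ : (2 ^ k : ℤ) • corner 0 = (0, 0) := by simp [corner, Prod.mk_zero_zero]
  have h₁ : (2 ^ k : ℤ) • corner 1 = (2 ^ k, 0) := by simp [corner]
  have h₂ : (2 ^ k : ℤ) • corner 2 = (0, 2 ^ k) := by simp [corner]
  rw [level, ← h₀, ← h₁, ← h₂]
  refine le_antisymm ?_ (iSup_le fun i => ?_)
  · exact sup_le (sup_le (le_iSup_of_le 0 le_rfl) (le_iSup_of_le 1 le_rfl))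
      (le_iSup_of_le 2 le_rfl)
  · fin_cases i
    exacts [le_sup_of_le_left le_sup_left, le_sup_of_le_left le_sup_right, le_sup_right]

theorem mem_map_shift_verts {H : (⊤ : SimpleGraph (ℤ × ℤ)).Subgraph} {a p : ℤ × ℤ} :
    p ∈ (H.map (shift a)).verts ↔ p - a ∈ H.verts :=
  ⟨fun ⟨q, hq, h⟩ => h ▸ by simpa [shift] using hq,
    fun h => ⟨p - a, h, sub_add_cancel p a⟩⟩

theorem map_shift_adj {H : (⊤ : SimpleGraph (ℤ × ℤ)).Subgraph} {a p q : ℤ × ℤ} :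
    (H.map (shift a)).Adj p q ↔ H.Adj (p - a) (q - a) :=
  ⟨fun ⟨x, y, h, hx, hy⟩ => hx ▸ hy ▸ by simpa [shift] using h,
    fun h => ⟨p - a, q - a, h, sub_add_cancel p a, sub_add_cancel q a⟩⟩

theorem level_zero :
    level 0 = (⊤ : (⊤ : SimpleGraph (ℤ × ℤ)).Subgraph).induce (Set.range corner) := by
  rw [level]
  congr
  ext
  simp only [corner, Set.mem_range, Fin.exists_fin_succ]
  simp [eq_comm, Prod.mk_zero_zero]

theorem mem_level_verts {k : ℕ} {p : ℤ × ℤ} :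
    p ∈ (level k).verts ↔ ∃ i, p - corner i ∈ cells k := by
  induction k generalizing p with
  | zero => simp [level_zero, cells, sub_eq_zero, eq_comm]
  | succ k ih =>
    simp only [level_succ, SimpleGraph.Subgraph.verts_iSup, Set.mem_iUnion, mem_map_shift_verts,
      ih, mem_cells_succ, sub_right_comm p]
    exact exists_comm

theorem level_adj {k : ℕ} {p q : ℤ × ℤ} : (level k).Adj p q ↔
    ∃ i, p - corner i ∈ cells k ∧ ∃ j, j ≠ i ∧ q = p + (corner j - corner i) := by
  induction k generalizing p q with
  | zero =>
    simp only [level_zero, SimpleGraph.Subgraph.induce_adj, SimpleGraph.Subgraph.top_adj,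
      SimpleGraph.top_adj, cells, Finset.mem_singleton, sub_eq_zero]
    constructor
    · rintro ⟨⟨i, rfl⟩, ⟨j, rfl⟩, hij⟩
      exact ⟨i, rfl, j, fun h => hij (h ▸ rfl), by simp⟩
    · rintro ⟨i, rfl, j, hij, rfl⟩
      simpa using fun h => hij (corner_injective h).symm
  | succ k ih =>
    simp only [level_succ, SimpleGraph.Subgraph.iSup_adj, map_shift_adj, ih, mem_cells_succ,
      ← add_sub_right_comm p, sub_left_inj, sub_right_comm p]
    rw [exists_comm]
    simp only [exists_and_right]

theorem mem_gasketPos_verts {p : ℤ × ℤ} : p ∈ gasketPos.verts ↔ (cornersAt p).Nonempty := by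
  simp only [gasketPos, SimpleGraph.Subgraph.verts_iSup, Set.mem_iUnion, mem_level_verts,
    Finset.Nonempty, mem_cornersAt, IsCell]
  exact exists_comm

theorem gasketPos_adj {p q : ℤ × ℤ} : gasketPos.Adj p q ↔
    ∃ i ∈ cornersAt p, ∃ j, j ≠ i ∧ q = p + (corner j - corner i) := by
  simp only [gasketPos, SimpleGraph.Subgraph.iSup_adj, level_adj, mem_cornersAt, IsCell]
  rw [exists_comm]
  simp only [exists_and_right]

theorem exists_units_int_iff {P : ℤˣ → Prop} : (∃ ε, P ε) ↔ P 1 ∨ P (-1) :=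
  ⟨fun ⟨ε, h⟩ => by rcases Int.units_eq_one_or ε with rfl | rfl <;> simp [h],
    fun h => h.elim (⟨1, ·⟩) (⟨-1, ·⟩)⟩

theorem mem_gasket_verts {p : ℤ × ℤ} :
    p ∈ gasket.verts ↔ ∃ ε : ℤˣ, (cornersAt (ε • p)).Nonempty := by
  simp [gasket, mem_gasketPos_verts, exists_units_int_iff, reflect]

theorem gasket_adj {p q : ℤ × ℤ} : gasket.Adj p q ↔
    ∃ ε : ℤˣ, ∃ i ∈ cornersAt (ε • p), ∃ j, j ≠ i ∧ q = p + ε • (corner j - corner i) := by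
  have hreflect : (gasketPos.map reflect).Adj p q ↔ gasketPos.Adj (-p) (-q) :=
    ⟨fun ⟨x, y, h, hx, hy⟩ => hx ▸ hy ▸ by simpa [reflect] using h,
      fun h => ⟨-p, -q, h, neg_neg p, neg_neg q⟩⟩
  simp only [gasket, SimpleGraph.Subgraph.sup_adj, hreflect, gasketPos_adj, exists_units_int_iff,
    one_smul, Units.neg_smul, neg_eq_iff_eq_neg, neg_add, neg_neg]

theorem units_smul_add_units_smul (ε : ℤˣ) (p q : ℤ × ℤ) : ε • (p + ε • q) = ε • p + q := by
  rw [smul_add, smul_smul, Int.units_mul_self, one_smul]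

theorem units_smul_eq_zero {ε : ℤˣ} {p : ℤ × ℤ} : ε • p = 0 ↔ p = 0 := smul_eq_zero_iff_eq ε

theorem cornersAt_neg_eq_empty {p : ℤ × ℤ} (hp : 0 ≤ p) (hp0 : p ≠ 0) : cornersAt (-p) = ∅ :=
  Finset.eq_empty_of_forall_notMem fun _ hi =>
    hp0 (le_antisymm (neg_nonneg.1 (nonneg_of_mem_cornersAt hi)) hp)

theorem exists_card_cornersAt_eq_two {p : ℤ × ℤ} (hp : p ∈ gasket.verts) (hp0 : p ≠ 0) :
    ∃ ε : ℤˣ, (cornersAt (ε • p)).card = 2 ∧ cornersAt (-(ε • p)) = ∅ := by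
  obtain ⟨ε, i, hi⟩ := mem_gasket_verts.1 hp
  have hne : ε • p ≠ 0 := units_smul_eq_zero.not.2 hp0
  exact ⟨ε, (card_cornersAt_eq_zero_or_two hne).resolve_left (Finset.card_ne_zero_of_mem hi),
    cornersAt_neg_eq_empty (nonneg_of_mem_cornersAt hi) hne⟩

theorem abs_height_units_smul (ε : ℤˣ) (p : ℤ × ℤ) : |height (ε • p)| = |height p| := by
  rcases Int.units_eq_one_or ε with rfl | rfl <;> simp

theorem abs_height_add_units_smul {ε : ℤˣ} {p : ℤ × ℤ} {i : Fin 3} (hi : i ∈ cornersAt (ε • p))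
    (j : Fin 3) : |height (p + ε • (corner j - corner i))| =
      |height p| - height (corner i) + height (corner j) := by
  have hcell := height_nonneg (mem_cornersAt.1 hi).nonneg
  have hi0 := height_nonneg (corner_nonneg i)
  have hj0 := height_nonneg (corner_nonneg j)
  rw [← abs_height_units_smul ε, units_smul_add_units_smul, ← abs_height_units_smul ε p]
  rw [map_sub] at hcell
  rw [map_add, map_sub, abs_of_nonneg (by lia), abs_of_nonneg (by lia)]
  lia

theorem SG_adj {y z : Vertex} : SG.Adj z y ↔
    ∃ ε : ℤˣ, ∃ i ∈ cornersAt (ε • z.1), ∃ j, j ≠ i ∧ y.1 = z.1 + ε • (corner j - corner i) :=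
  gasket_adj

theorem exists_SG_adj {z : Vertex} {ε : ℤˣ} {i j : Fin 3} (hi : i ∈ cornersAt (ε • z.1))
    (hj : j ≠ i) : ∃ y : Vertex, SG.Adj z y ∧ y.1 = z.1 + ε • (corner j - corner i) := by
  have hadj : gasket.Adj z.1 (z.1 + ε • (corner j - corner i)) :=
    gasket_adj.2 ⟨ε, i, hi, j, hj, rfl⟩
  exact ⟨⟨_, hadj.snd_mem⟩, hadj, rfl⟩

theorem coe_origin : (origin : ℤ × ℤ) = 0 := rfl

theorem coe_eq_zero {z : Vertex} : z.1 = 0 ↔ z = origin := by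
  rw [Subtype.ext_iff, coe_origin]

theorem exists_adj_natAbs_height_add_one {z : Vertex} (hz : z ≠ origin) :
    ∃ y, SG.Adj z y ∧ (height y.1).natAbs + 1 = (height z.1).natAbs := by
  obtain ⟨ε, hcard, -⟩ := exists_card_cornersAt_eq_two z.2 (coe_eq_zero.not.2 hz)
  obtain ⟨i, hi, hi0⟩ := Finset.exists_mem_ne (hcard ▸ one_lt_two) 0
  obtain ⟨y, hzy, hy⟩ := exists_SG_adj hi hi0.symm
  have hdesc := abs_height_add_units_smul hi 0
  rw [← hy, height_corner, height_corner, if_neg hi0, if_pos rfl, Int.abs_eq_natAbs,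
    Int.abs_eq_natAbs] at hdesc
  exact ⟨y, hzy, by lia⟩

theorem natAbs_height_le_add_one ⦃z y : Vertex⦄ (hzy : SG.Adj z y) :
    (height y.1).natAbs ≤ (height z.1).natAbs + 1 := by
  obtain ⟨ε, i, hi, j, -, hy⟩ := SG_adj.1 hzy
  have hstep := abs_height_add_units_smul hi j
  rw [← hy, height_corner, height_corner, Int.abs_eq_natAbs, Int.abs_eq_natAbs] at hstep
  split_ifs at hstep <;> lia

theorem dist_origin (z : Vertex) : (SG.dist origin z : ℤ) = |height z.1| := by
  rw [dist_eq_of_descent (f := fun z => (height z.1).natAbs) (by simp [coe_origin])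
    natAbs_height_le_add_one (fun _ => exists_adj_natAbs_height_add_one), Int.natCast_natAbs]

theorem preconnected_SG : SG.Preconnected := by
  have hreach (z : Vertex) : SG.Reachable origin z :=
    (exists_walk_length_eq_of_descent (f := fun z => (height z.1).natAbs) (by simp [coe_origin])
      (fun _ => exists_adj_natAbs_height_add_one) z).elim fun w _ => w.reachable
  exact fun y z => (hreach y).symm.trans (hreach z)

theorem mem_ball {n : ℤ} {z : Vertex} : z ∈ ball n ↔ |height z.1| ≤ n := by
  rw [ball, Set.mem_ofPred_eq, dist_origin]

theorem mem_innerBoundary_ball {n : ℤ} {z : Vertex} : z ∈ innerBoundary (ball n) ↔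
    |height z.1| = n ∧ ∃ ε : ℤˣ, 0 ∈ cornersAt (ε • z.1) := by
  simp only [innerBoundary, Set.mem_ofPred_eq, mem_ball, not_le]
  constructor
  · rintro ⟨hz, y, hy, hzy⟩
    obtain ⟨ε, i, hi, j, -, hy'⟩ := SG_adj.1 hzy
    rw [hy', abs_height_add_units_smul hi, height_corner, height_corner] at hy
    obtain rfl : i = 0 := by
      by_contra hi0
      rw [if_neg hi0] at hy
      split_ifs at hy <;> lia
    exact ⟨by split_ifs at hy <;> lia, ε, hi⟩
  · rintro ⟨hz, ε, hi⟩
    obtain ⟨y, hzy, hy⟩ := exists_SG_adj hi one_ne_zero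
    refine ⟨hz.le, y, ?_, hzy⟩
    rw [hy, abs_height_add_units_smul hi, height_corner, height_corner, hz]
    simp

theorem finite_ball (n : ℤ) : (ball n).Finite := by
  refine ((Set.finite_Icc (-n, -n) (n, n)).preimage Subtype.val_injective.injOn).subset
    fun z hz => ?_
  obtain ⟨ε, i, hi⟩ := mem_gasket_verts.1 z.2
  obtain ⟨h₁, h₂⟩ := nonneg_of_mem_cornersAt hi
  rw [mem_ball, height_apply] at hz
  rw [Set.mem_preimage, Set.mem_Icc, Prod.le_def, Prod.le_def]
  rcases Int.units_eq_one_or ε with rfl | rfl <;> simp at h₁ h₂ <;> grind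

instance : Infinite Vertex := by
  have hmem (k : ℕ) : (2 ^ k : ℤ) • corner 1 ∈ gasket.verts :=
    mem_gasket_verts.2
      ⟨1, 0, by simpa [mem_cornersAt, corner] using isCell_two_pow_zsmul_corner k 1⟩
  refine Infinite.of_injective (fun k : ℕ => (⟨_, hmem k⟩ : Vertex)) fun k l hkl => ?_
  simpa [corner] using hkl

/-! ### The Laplacian -/

theorem sum_units_int {M : Type*} [AddCommMonoid M] (g : ℤˣ → M) (ε : ℤˣ) :
    ∑ ε', g ε' = g ε + g (-ε) := by
  rcases Int.units_eq_one_or ε with rfl | rfl <;> simp [UnitsInt.univ, add_comm]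

theorem sum_card_cornersAt {p : ℤ × ℤ} (hp : p ∈ gasket.verts) :
    ∑ ε : ℤˣ, (cornersAt (ε • p)).card = 2 := by
  by_cases hp0 : p = 0
  · simp [hp0, cornersAt_zero]
  · obtain ⟨ε, hε, hneg⟩ := exists_card_cornersAt_eq_two hp hp0
    rw [sum_units_int _ ε, hε, Units.neg_smul, hneg, Finset.card_empty]

theorem corner_sub_corner_injOn :
    ∀ i j i' j' : Fin 3, j ≠ i → corner j - corner i = corner j' - corner i' → i = i' ∧ j = j' := by
  decide

theorem corner_sub_ne_neg_corner_sub :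
    ∀ j j' : Fin 3, j ≠ 0 → corner j - corner 0 ≠ -(corner j' - corner 0) := by
  decide

theorem step_injective {p : ℤ × ℤ} {ε ε' : ℤˣ} {i i' j j' : Fin 3} (hi : i ∈ cornersAt (ε • p))
    (hi' : i' ∈ cornersAt (ε' • p)) (hj : j ≠ i)
    (h : ε • (corner j - corner i) = ε' • (corner j' - corner i')) :
    ε = ε' ∧ i = i' ∧ j = j' := by
  obtain rfl | rfl : ε' = ε ∨ ε' = -ε := by
    rcases Int.units_eq_one_or ε with rfl | rfl <;> rcases Int.units_eq_one_or ε' with rfl | rfl <;>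
      simp
  · exact ⟨rfl, corner_sub_corner_injOn _ _ _ _ hj (smul_left_cancel ε' h)⟩
  · have hp : ε • p = 0 := by
      refine le_antisymm (neg_nonneg.1 ?_) (nonneg_of_mem_cornersAt hi)
      simpa using nonneg_of_mem_cornersAt hi'
    rw [Units.neg_smul, hp, neg_zero, cornersAt_zero, Finset.mem_singleton] at hi'
    rw [hp, cornersAt_zero, Finset.mem_singleton] at hi
    subst hi hi'
    rw [Units.neg_smul, ← smul_neg] at h
    exact absurd (smul_left_cancel ε h) (corner_sub_ne_neg_corner_sub j j' hj)

noncomputable instance : SG.LocallyFinite := fun z =>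
  ((finite_ball (|height z.1| + 1)).subset fun y hy => by
    have := natAbs_height_le_add_one hy
    rw [mem_ball, Int.abs_eq_natAbs, Int.abs_eq_natAbs]
    lia).fintype

theorem sum_neighborFinset {M : Type*} [AddCommMonoid M] (F : ℤ × ℤ → M) (z : Vertex) :
    ∑ y ∈ SG.neighborFinset z, F y =
      ∑ ε : ℤˣ, ∑ i ∈ cornersAt (ε • z.1), ∑ j ∈ {i}ᶜ, F (z.1 + ε • (corner j - corner i)) := by
  classical
  let steps : Finset ((_ : ℤˣ) × (_ : Fin 3) × Fin 3) :=
    Finset.univ.sigma fun ε => (cornersAt (ε • z.1)).sigma fun i => {i}ᶜ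
  let target (s : (_ : ℤˣ) × (_ : Fin 3) × Fin 3) : ℤ × ℤ :=
    z.1 + s.1 • (corner s.2.2 - corner s.2.1)
  have hsteps {ε : ℤˣ} {i j : Fin 3} : ⟨ε, i, j⟩ ∈ steps ↔ i ∈ cornersAt (ε • z.1) ∧ j ≠ i := by
    simp only [steps, Finset.mem_sigma, Finset.mem_univ, true_and, Finset.mem_compl,
      Finset.mem_singleton]
  have himage : (SG.neighborFinset z).image Subtype.val = steps.image target := by
    ext q
    simp only [Finset.mem_image, SimpleGraph.mem_neighborFinset]
    constructor
    · rintro ⟨y, hzy, rfl⟩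
      obtain ⟨ε, i, hi, j, hj, hy⟩ := SG_adj.1 hzy
      exact ⟨⟨ε, i, j⟩, hsteps.2 ⟨hi, hj⟩, hy.symm⟩
    · rintro ⟨⟨ε, i, j⟩, hs, rfl⟩
      exact (exists_SG_adj (hsteps.1 hs).1 (hsteps.1 hs).2)
  have hinj : Set.InjOn target steps := by
    rintro ⟨ε, i, j⟩ hs ⟨ε', i', j'⟩ hs' h
    obtain ⟨rfl, rfl, rfl⟩ := step_injective (hsteps.1 hs).1 (hsteps.1 hs').1 (hsteps.1 hs).2
      (add_left_cancel h)
    rfl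
  rw [← Finset.sum_image Subtype.val_injective.injOn, himage, Finset.sum_image hinj,
    Finset.sum_sigma]
  simp only [Finset.sum_sigma, target]

theorem degree_SG (z : Vertex) : SG.degree z = 4 := by
  have hsum := sum_neighborFinset (fun _ => 1) z
  simp only [Finset.sum_const, SimpleGraph.card_neighborFinset_eq_degree, Finset.card_compl,
    Finset.card_singleton, Fintype.card_fin, smul_eq_mul, mul_one, ← Finset.sum_mul,
    sum_card_cornersAt z.2] at hsum
  exact hsum

theorem laplacian_eq_sum (f : Vertex → ℝ) (z : Vertex) :
    laplacian f z = 1 / 4 * ∑ y ∈ SG.neighborFinset z, f y - f z := by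
  rw [laplacian, ← finsum_mem_coe_finset, SimpleGraph.coe_neighborFinset]

theorem laplacian_eq_sum_sub (f : Vertex → ℝ) (z : Vertex) :
    laplacian f z = 1 / 4 * ∑ y ∈ SG.neighborFinset z, (f y - f z) := by
  rw [laplacian_eq_sum, Finset.sum_sub_distrib, Finset.sum_const,
    SimpleGraph.card_neighborFinset_eq_degree, degree_SG, nsmul_eq_mul]
  push_cast
  ring

theorem sum_laplacian_eq_zero {S : Finset Vertex} {u : Vertex → ℝ}
    (hu : ∀ z ∈ S, ∀ y ∉ S, SG.Adj z y → u y = u z) : ∑ z ∈ S, laplacian u z = 0 := by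
  simp only [laplacian_eq_sum_sub, ← Finset.mul_sum, sum_sum_neighborFinset_sub_eq_zero hu,
    mul_zero]

theorem laplacian_comp_coe (F : ℤ × ℤ → ℝ) (z : Vertex) : laplacian (fun y => F y) z =
    1 / 4 * ∑ ε : ℤˣ, ∑ i ∈ cornersAt (ε • z.1), ∑ j,
      (F (z.1 + ε • (corner j - corner i)) - F z) := by
  rw [laplacian_eq_sum_sub, sum_neighborFinset (fun p => F p - F z)]
  refine congrArg _ (Finset.sum_congr rfl fun ε _ => Finset.sum_congr rfl fun i _ => ?_)
  refine Finset.sum_subset (Finset.subset_univ _) fun j _ hj => ?_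
  obtain rfl : j = i := by simpa using hj
  simp

theorem laplacian_add (f g : Vertex → ℝ) (z : Vertex) :
    laplacian (fun y => f y + g y) z = laplacian f z + laplacian g z := by
  simp only [laplacian_eq_sum_sub, add_sub_add_comm, Finset.sum_add_distrib, mul_add]

theorem laplacian_const_mul (c : ℝ) (f : Vertex → ℝ) (z : Vertex) :
    laplacian (fun y => c * f y) z = c * laplacian f z := by
  simp only [laplacian_eq_sum_sub, ← mul_sub, ← Finset.mul_sum]
  ring

theorem laplacian_sub (f g : Vertex → ℝ) (z : Vertex) :
    laplacian (fun y => f y - g y) z = laplacian f z - laplacian g z := by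
  simp only [laplacian_eq_sum_sub, sub_sub_sub_comm _ (g _), Finset.sum_sub_distrib, mul_sub]

theorem pointMass_self (z : Vertex) : pointMass z z = 1 := Pi.single_eq_same z 1

theorem laplacian_pointMass_self (z : Vertex) : laplacian (pointMass z) z = -1 := by
  have hterm : ∀ y ∈ SG.neighborFinset z, pointMass z y = 0 := by
    intro y hy
    have hne : y ≠ z := ((SG.mem_neighborFinset z y).1 hy).ne'
    simp [pointMass, hne]
  rw [laplacian_eq_sum, Finset.sum_eq_zero hterm, pointMass_self]
  norm_num

theorem laplacian_add_self_le {f g : Vertex → ℝ} (h : ∀ y, f y ≤ g y) (z : Vertex) :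
    laplacian f z + f z ≤ laplacian g z + g z := by
  rw [laplacian_eq_sum, laplacian_eq_sum, sub_add_cancel, sub_add_cancel]
  gcongr
  exact h _

theorem tendsto_laplacian {ι : Type*} {l : Filter ι} {f : ι → Vertex → ℝ} {g : Vertex → ℝ}
    (h : ∀ z, Tendsto (fun k => f k z) l (𝓝 (g z))) (z : Vertex) :
    Tendsto (fun k => laplacian (f k) z) l (𝓝 (laplacian g z)) := by
  simp only [laplacian_eq_sum]
  exact ((tendsto_finsetSum _ fun y _ => h y).const_mul _).sub (h z)

/-! ### The divisible sandpile -/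

section Sandpile

variable {μ₀ u : Vertex → ℝ} {x : ℕ → Vertex}

theorem emitted_zero : emitted μ₀ x 0 = 0 := by
  ext y
  simp [emitted]

theorem emitted_succ (k : ℕ) : emitted μ₀ x (k + 1) =
    fun y => emitted μ₀ x k y + max (sand μ₀ x k (x k) - 1) 0 * pointMass (x k) y := by
  ext y
  rw [emitted, Finset.sum_filter, Finset.sum_range_succ, ← Finset.sum_filter, ← emitted]
  rcases eq_or_ne (x k) y with rfl | hy
  · simp [sand, topple, laplacian_pointMass_self, pointMass_self]
  · simp [hy, hy.symm, pointMass]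

theorem sand_eq_add_laplacian_emitted (k : ℕ) (z : Vertex) :
    sand μ₀ x k z = μ₀ z + laplacian (emitted μ₀ x k) z := by
  induction k generalizing z with
  | zero => simp [sand, emitted_zero, laplacian]
  | succ k ih =>
    rw [sand, topple, ih z, emitted_succ, laplacian_add, laplacian_const_mul, add_assoc]

theorem monotone_emitted (z : Vertex) : Monotone fun k => emitted μ₀ x k z := by
  refine monotone_nat_of_le_succ fun k => ?_
  rw [emitted_succ]
  have hmass : 0 ≤ pointMass (x k) z := by
    rw [pointMass, Pi.single_apply]
    split_ifs <;> norm_num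
  exact le_add_of_nonneg_right (mul_nonneg (le_max_right _ _) hmass)

theorem emitted_nonneg (k : ℕ) (z : Vertex) : 0 ≤ emitted μ₀ x k z := by
  simpa [emitted_zero] using monotone_emitted (μ₀ := μ₀) (x := x) z k.zero_le

-- The least action principle: just after a nontrivial toppling the sand at the toppled vertex is
-- `1`, so the mass emitted there is determined by the mass emitted at its neighbours.
theorem emitted_le (hu : ∀ z, 0 ≤ u z) (hle : ∀ z, μ₀ z + laplacian u z ≤ 1) (k : ℕ)
    (z : Vertex) : emitted μ₀ x k z ≤ u z := by
  induction k generalizing z with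
  | zero => simpa [emitted_zero] using hu z
  | succ k ih =>
    rw [emitted_succ]
    rcases eq_or_ne z (x k) with rfl | hz
    · have hmono := laplacian_add_self_le ih (x k)
      have hmax : max (sand μ₀ x k (x k) - 1) 0 ≤ u (x k) - emitted μ₀ x k (x k) := by
        rw [sand_eq_add_laplacian_emitted]
        exact max_le (by linarith [hle (x k)]) (sub_nonneg.2 (ih _))
      simpa [pointMass] using add_le_of_le_sub_left hmax
    · simpa [pointMass, hz] using ih z

theorem add_laplacian_le_one_of_tendsto_emitted (hx : IsTopplingSequence x)
    (h : ∀ z, Tendsto (fun k => emitted μ₀ x k z) atTop (𝓝 (u z))) (z : Vertex) :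
    μ₀ z + laplacian u z ≤ 1 := by
  have hsand : Tendsto (fun k => sand μ₀ x k z) atTop (𝓝 (μ₀ z + laplacian u z)) := by
    simp only [sand_eq_add_laplacian_emitted]
    exact (tendsto_laplacian h z).const_add _
  have hdiff : Tendsto (fun k => emitted μ₀ x (k + 1) z - emitted μ₀ x k z) atTop (𝓝 0) := by
    simpa using ((h z).comp (tendsto_add_atTop_nat 1)).sub (h z)
  have hrest := hsand.sub hdiff
  rw [sub_zero] at hrest
  refine le_of_tendsto_of_frequently hrest ((hx z).mono fun k hk => ?_)
  subst hk
  simp only [emitted_succ, pointMass_self, mul_one]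
  linarith [le_max_left (sand μ₀ x k (x k) - 1) 0]

theorem exists_tendsto_emitted (hu : ∀ z, 0 ≤ u z) (hle : ∀ z, μ₀ z + laplacian u z ≤ 1)
    (x : ℕ → Vertex) : ∃ v : Vertex → ℝ, (∀ z, 0 ≤ v z ∧ v z ≤ u z) ∧
      ∀ z, Tendsto (fun k => emitted μ₀ x k z) atTop (𝓝 (v z)) := by
  have hbdd (z : Vertex) : BddAbove (Set.range fun k => emitted μ₀ x k z) :=
    ⟨u z, Set.forall_mem_range.2 fun k => emitted_le hu hle k z⟩
  refine ⟨fun z => ⨆ k, emitted μ₀ x k z, fun z => ⟨?_, ciSup_le fun k => emitted_le hu hle k z⟩,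
    fun z => tendsto_atTop_ciSup (monotone_emitted z) (hbdd z)⟩
  exact Real.iSup_nonneg fun k => emitted_nonneg k z

theorem isOdometer_of_add_laplacian_eq_one (hu : ∀ z, 0 ≤ u z) (hfin : (cluster u).Finite)
    (hle : ∀ z, μ₀ z + laplacian u z ≤ 1) (hfull : ∀ z ∈ cluster u, μ₀ z + laplacian u z = 1) :
    IsOdometer μ₀ u := by
  intro x hx
  obtain ⟨v, hv, hlim⟩ := exists_tendsto_emitted hu hle x
  have hpos {z : Vertex} (hz : 0 < u z - v z) : z ∈ cluster u := by
    have := (hv z).1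
    simp only [cluster, Set.mem_ofPred_eq]
    linarith
  obtain ⟨o, ho⟩ := hfin.exists_notMem
  have hcompare : ∀ z, u z - v z ≤ 0 := by
    refine nonpos_of_subharmonic preconnected_SG (hfin.subset fun z => hpos) (fun z hz => ?_)
      ⟨o, not_lt.1 fun h => ho (hpos h)⟩
    have hsub : 0 ≤ laplacian (fun y => u y - v y) z := by
      rw [laplacian_sub]
      linarith [hfull z (hpos hz), add_laplacian_le_one_of_tendsto_emitted hx hlim z]
    rw [laplacian_eq_sum_sub] at hsub
    linarith
  intro z
  rw [le_antisymm (sub_nonpos.1 (hcompare z)) (hv z).2]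
  exact hlim z

theorem IsOdometer.isLimitSand (h : IsOdometer μ₀ u) :
    IsLimitSand μ₀ fun z => μ₀ z + laplacian u z := by
  intro x hx z
  simp only [sand_eq_add_laplacian_emitted]
  exact (tendsto_laplacian (h x hx) z).const_add _

end Sandpile

/-! ### Potentials on the one-sided gasket -/

/-- The Laplacian of the network `G_k` applied to `f`, integrated against the test function `h`:
each triangle with corners `p`, `q`, `r` contributes `h p * (f q + f r - 2 * f p)` at `p`. Working
with test functions avoids a separate discussion of the points where copies of `G_k` meet. -/
def levelForm (k : ℕ) (f h : ℤ × ℤ → ℝ) : ℝ :=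
  ∑ t ∈ cells k, ∑ i, h (t + corner i) * ∑ j, (f (t + corner j) - f (t + corner i))

theorem levelForm_congr {k : ℕ} {f g : ℤ × ℤ → ℝ} (h : ℤ × ℤ → ℝ)
    (hfg : ∀ p, 0 ≤ p → height p ≤ 2 ^ k → f p = g p) : levelForm k f h = levelForm k g h := by
  refine Finset.sum_congr rfl fun t ht => Finset.sum_congr rfl fun i _ => ?_
  obtain ⟨hnonneg, hlt⟩ := nonneg_and_height_lt ht
  have hcorner (j : Fin 3) : f (t + corner j) = g (t + corner j) := by
    refine hfg _ (add_nonneg hnonneg (corner_nonneg j)) ?_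
    rw [map_add, height_corner]
    split_ifs <;> lia
  simp only [hcorner]

theorem levelForm_zero (k : ℕ) (h : ℤ × ℤ → ℝ) : levelForm k (fun _ => 0) h = 0 := by
  simp [levelForm]

theorem levelForm_add (k : ℕ) (f g h : ℤ × ℤ → ℝ) :
    levelForm k (fun p => f p + g p) h = levelForm k f h + levelForm k g h := by
  simp only [levelForm, add_sub_add_comm, Finset.sum_add_distrib, mul_add]

theorem levelForm_succ (k : ℕ) (f h : ℤ × ℤ → ℝ) : levelForm (k + 1) f h =
    ∑ i, levelForm k (fun p => f (p + (2 ^ k : ℤ) • corner i))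
      fun p => h (p + (2 ^ k : ℤ) • corner i) := by
  simp only [levelForm, sum_cells_succ, add_right_comm]

/-- The function that equals a translate of `f i` on the `i`-th of the three triangles of side `m`
with lower-left corners `m • corner i`. Functions on `G_{k+1}` are assembled in this way from
functions on `G_k`, with `m = 2 ^ k`. -/
def glue (m : ℤ) (f : Fin 3 → ℤ × ℤ → ℝ) (p : ℤ × ℤ) : ℝ :=
  if m ≤ p.1 then f 1 (p - m • corner 1)
  else if m ≤ p.2 then f 2 (p - m • corner 2)
  else f 0 p

theorem glue_add {m : ℤ} (hm : 0 < m) {f : Fin 3 → ℤ × ℤ → ℝ}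
    (hf : ∀ i j, f i (m • corner j) = f j (m • corner i)) {p : ℤ × ℤ} (hp : 0 ≤ p)
    (hpm : height p ≤ m) (i : Fin 3) : glue m f (p + m • corner i) = f i p := by
  obtain ⟨a, b⟩ := p
  obtain ⟨ha, hb⟩ : 0 ≤ a ∧ 0 ≤ b := hp
  rw [height_apply] at hpm
  have h₀₁ := hf 0 1
  have h₀₂ := hf 0 2
  have h₁₂ := hf 1 2
  simp only [corner] at h₀₁ h₀₂ h₁₂
  by_cases h₁ : m ≤ a
  · obtain ⟨rfl, rfl⟩ : a = m ∧ b = 0 := by lia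
    fin_cases i <;> simp_all [glue, corner]
  by_cases h₂ : m ≤ b
  · obtain ⟨rfl, rfl⟩ : a = 0 ∧ b = m := by lia
    fin_cases i <;> simp_all [glue, corner]
  fin_cases i <;> simp [glue, corner, h₁, h₂, ha, hb]

theorem glue_pos {m : ℤ} {f : Fin 3 → ℤ × ℤ → ℝ} {p : ℤ × ℤ} (h₀ : 0 < f 0 p)
    (h₁ : 0 < f 1 (p - m • corner 1)) (h₂ : 0 < f 2 (p - m • corner 2)) : 0 < glue m f p := by
  rw [glue]
  split_ifs <;> assumption

theorem levelForm_glue {k : ℕ} {f : Fin 3 → ℤ × ℤ → ℝ}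
    (hf : ∀ i j, f i ((2 ^ k : ℤ) • corner j) = f j ((2 ^ k : ℤ) • corner i))
    (h : ℤ × ℤ → ℝ) : levelForm (k + 1) (glue (2 ^ k) f) h =
      ∑ i, levelForm k (f i) fun p => h (p + (2 ^ k : ℤ) • corner i) := by
  rw [levelForm_succ]
  exact Finset.sum_congr rfl fun i _ =>
    levelForm_congr _ fun p hp hpk => glue_add (by positivity) hf hp hpk i

/-- The `2/5`-`2/5`-`1/5` rule: `subdivide a i j` is the value at the midpoint of the `i`-th and the
`j`-th corner of a triangle, of the function which has the values `a` at the three corners and is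
harmonic at the three midpoints. -/
noncomputable def subdivide (a : Fin 3 → ℝ) (i j : Fin 3) : ℝ :=
  if i = j then a i else (a i + a j + ∑ l, a l) / 5

theorem subdivide_self (a : Fin 3 → ℝ) (i : Fin 3) : subdivide a i i = a i := if_pos rfl

theorem subdivide_comm (a : Fin 3 → ℝ) (i j : Fin 3) : subdivide a i j = subdivide a j i := by
  rcases eq_or_ne i j with rfl | hij
  · rfl
  · rw [subdivide, subdivide, if_neg hij, if_neg hij.symm, add_comm (a i)]

theorem subdivide_pos {a : Fin 3 → ℝ} (ha : ∀ i, 0 < a i) (i j : Fin 3) :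
    0 < subdivide a i j := by
  have hsum : 0 < ∑ l, a l := Finset.sum_pos (fun l _ => ha l) Finset.univ_nonempty
  have hi := ha i
  have hj := ha j
  rw [subdivide]
  split_ifs <;> positivity

/-- The function on `G_k` with the values `a i` at the extreme vertices `2 ^ k • corner i` that is
harmonic at all the other vertices. -/
noncomputable def harmonicExt : ℕ → (Fin 3 → ℝ) → ℤ × ℤ → ℝ
  | 0, a => glue 1 fun i _ => a i
  | k + 1, a => glue (2 ^ k) fun i => harmonicExt k (subdivide a i)

theorem two_pow_succ_zsmul_corner (k : ℕ) (i : Fin 3) :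
    (2 ^ (k + 1) : ℤ) • corner i = (2 ^ k : ℤ) • corner i + (2 ^ k : ℤ) • corner i := by
  rw [pow_succ, mul_two, add_smul]

theorem harmonicExt_corner (k : ℕ) (a : Fin 3 → ℝ) (i : Fin 3) :
    harmonicExt k a ((2 ^ k : ℤ) • corner i) = a i := by
  induction k generalizing a i with
  | zero => fin_cases i <;> simp [harmonicExt, glue, corner]
  | succ k ih =>
    have hpow : (0 : ℤ) < 2 ^ k := by positivity
    rw [harmonicExt, two_pow_succ_zsmul_corner, glue_add hpow, ih, subdivide_self]
    · exact fun i j => by rw [ih, ih, subdivide_comm]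
    · exact smul_nonneg hpow.le (corner_nonneg i)
    · rw [height_zsmul_corner]
      split_ifs <;> lia

theorem levelForm_harmonicExt (k : ℕ) (a : Fin 3 → ℝ) (h : ℤ × ℤ → ℝ) :
    levelForm k (harmonicExt k a) h =
      (3 / 5) ^ k * ∑ i, h ((2 ^ k : ℤ) • corner i) * ∑ j, (a j - a i) := by
  induction k generalizing a h with
  | zero =>
    have hcorner := harmonicExt_corner 0 a
    simp only [pow_zero, one_smul] at hcorner
    simp [levelForm, cells, hcorner]
  | succ k ih =>
    rw [harmonicExt, levelForm_glue fun i j => by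
      rw [harmonicExt_corner, harmonicExt_corner, subdivide_comm]]
    simp only [ih, two_pow_succ_zsmul_corner, Fin.sum_univ_three, subdivide]
    simp only [corner, Fin.isValue, Matrix.cons_val_zero, smul_zero, add_zero, ↓reduceIte, sub_self,
      zero_ne_one, zero_add, Fin.reduceEq, Matrix.cons_val_one, Prod.smul_mk, Int.zsmul_eq_mul,
      mul_one, Matrix.cons_val, one_ne_zero, Prod.mk_add_mk]
    ring

theorem harmonicExt_pos {k : ℕ} {a : Fin 3 → ℝ} (ha : ∀ i, 0 < a i) (p : ℤ × ℤ) :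
    0 < harmonicExt k a p := by
  induction k generalizing a p with
  | zero => exact glue_pos (ha 0) (ha 1) (ha 2)
  | succ k ih =>
    exact glue_pos (ih (subdivide_pos ha 0) _) (ih (subdivide_pos ha 1) _)
      (ih (subdivide_pos ha 2) _)

/-- The values at the extreme vertices of `G_k` of the harmonic summand in `ballPotential`. -/
noncomputable def inflowValues (k : ℕ) (c N : ℝ) (i : Fin 3) : ℝ :=
  c + if i = 0 then 6 * (5 / 3) ^ k * N else 0

theorem levelForm_harmonicExt_inflowValues (k : ℕ) (c N : ℝ) (h : ℤ × ℤ → ℝ) :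
    levelForm k (harmonicExt k (inflowValues k c N)) h =
      6 * N * ∑ i, (h ((2 ^ k : ℤ) • corner i) - h 0) := by
  have hscale : (3 / 5 : ℝ) ^ k * (5 / 3) ^ k = 1 := by
    rw [← mul_pow]
    norm_num
  rw [levelForm_harmonicExt]
  simp only [inflowValues, Fin.sum_univ_three]
  simp only [corner, Fin.isValue, Matrix.cons_val_zero, smul_zero, ↓reduceIte, sub_self,
    one_ne_zero, add_zero, sub_add_cancel_left, zero_add, Fin.reduceEq, Matrix.cons_val_one,
    Prod.smul_mk, Int.zsmul_eq_mul, mul_one, add_sub_cancel_left, Matrix.cons_val]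
  linear_combination 6 * N * (h (2 ^ k, 0) + h (0, 2 ^ k) - 2 * h 0) * hscale

/-- Functions on the three copies of `G_k` in `G_{k+1}`: `g` on the two outer ones, and `f` plus a
harmonic function on the lower-left one. The harmonic function provides continuity, and brings to
the two outer copies the mass that `g` takes from there to `N` triangles. -/
noncomputable def pieces (k : ℕ) (f g : ℤ × ℤ → ℝ) (N : ℝ) : Fin 3 → ℤ × ℤ → ℝ :=
  ![fun p => f p + harmonicExt k (inflowValues k (g 0) N) p, g, g]

theorem pieces_compatible {k : ℕ} {f g : ℤ × ℤ → ℝ} (N : ℝ)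
    (hf : ∀ i ≠ 0, f ((2 ^ k : ℤ) • corner i) = 0)
    (hg : ∀ i ≠ 0, g ((2 ^ k : ℤ) • corner i) = 0) (i j : Fin 3) :
    pieces k f g N i ((2 ^ k : ℤ) • corner j) = pieces k f g N j ((2 ^ k : ℤ) • corner i) := by
  have hzero : (2 ^ k : ℤ) • corner 0 = 0 := smul_zero _
  fin_cases i <;> fin_cases j <;>
    simp [-zsmul_eq_mul, pieces, harmonicExt_corner, inflowValues, hzero, hf, hg]

/-- For `0 ≤ n ≤ 2 ^ k`, the function on `G_k` that vanishes at height at least `n` and whose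
Laplacian moves mass `2` from the origin to each corner of each triangle whose lower-left corner has
height less than `n`, see `levelForm_ballPotential`. -/
noncomputable def ballPotential : ℕ → ℤ → ℤ × ℤ → ℝ
  | 0, n, p => if height p < n then 2 else 0
  | k + 1, n, p =>
      if n ≤ 2 ^ k then ballPotential k n p
      else if height p < n then
        glue (2 ^ k) (pieces k (ballPotential k (2 ^ k)) (ballPotential k (n - 2 ^ k))
          (Finset.card {t ∈ cells k | height t < n - 2 ^ k})) p
      else 0

theorem ballPotential_eq_zero (k : ℕ) {n : ℤ} {p : ℤ × ℤ} (hp : n ≤ height p) :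
    ballPotential k n p = 0 := by
  induction k with
  | zero => rw [ballPotential, if_neg hp.not_gt]
  | succ k ih => rw [ballPotential, ih, if_neg hp.not_gt, ite_self]

theorem ballPotential_pos {k : ℕ} {n : ℤ} (hn : n ≤ 2 ^ k) {p : ℤ × ℤ} (hp : height p < n) :
    0 < ballPotential k n p := by
  induction k generalizing n p with
  | zero => simp [ballPotential, hp]
  | succ k ih =>
    rw [ballPotential]
    split_ifs with hnk
    · exact ih hnk hp
    have hnk' : n - 2 ^ k ≤ 2 ^ k := by rw [pow_succ] at hn; lia
    have hnonneg : 0 ≤ ballPotential k (2 ^ k) p := by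
      rcases lt_or_ge (height p) (2 ^ k) with hlt | hge
      exacts [(ih le_rfl hlt).le, (ballPotential_eq_zero k hge).ge]
    refine glue_pos (add_pos_of_nonneg_of_pos hnonneg (harmonicExt_pos (fun i => ?_) p)) ?_ ?_
    · refine add_pos_of_pos_of_nonneg (ih hnk' ?_) (by positivity)
      rw [map_zero]
      lia
    all_goals
      refine ih hnk' ?_
      rw [map_sub, height_zsmul_corner]
      simpa using hp

theorem ballPotential_succ_of_le {k : ℕ} {n : ℤ} (hn : n ≤ 2 ^ k) :
    ballPotential (k + 1) n = ballPotential k n := by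
  ext p
  rw [ballPotential, if_pos hn]

theorem levelForm_ballPotential_succ_of_le {k : ℕ} {n : ℤ} (hn : n ≤ 2 ^ k) (h : ℤ × ℤ → ℝ) :
    levelForm (k + 1) (ballPotential (k + 1) n) h = levelForm k (ballPotential k n) h := by
  have houter {i : Fin 3} (hi : i ≠ 0) :
      levelForm k (fun p => ballPotential k n (p + (2 ^ k : ℤ) • corner i))
        (fun p => h (p + (2 ^ k : ℤ) • corner i)) = 0 := by
    rw [levelForm_congr (g := fun _ => 0), levelForm_zero]
    intro p hp _
    refine ballPotential_eq_zero k ?_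
    rw [map_add, height_zsmul_corner, if_neg hi]
    linarith [height_nonneg hp]
  rw [ballPotential_succ_of_le hn, levelForm_succ,
    Finset.sum_eq_single 0 (fun i _ hi => houter hi) (by simp)]
  simp [corner]

theorem ballPotential_zsmul_corner {k : ℕ} {n : ℤ} (hn : n ≤ 2 ^ k) {i : Fin 3} (hi : i ≠ 0) :
    ballPotential k n ((2 ^ k : ℤ) • corner i) = 0 :=
  ballPotential_eq_zero k (by rwa [height_zsmul_corner, if_neg hi])

theorem ballPotential_succ_add {k : ℕ} {n : ℤ} (hn : 2 ^ k < n) (hn' : n ≤ 2 ^ (k + 1))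
    {p : ℤ × ℤ} (hp : 0 ≤ p) (hpk : height p ≤ 2 ^ k) (i : Fin 3) :
    ballPotential (k + 1) n (p + (2 ^ k : ℤ) • corner i) =
      pieces k (ballPotential k (2 ^ k)) (ballPotential k (n - 2 ^ k))
        (Finset.card {t ∈ cells k | height t < n - 2 ^ k}) i p := by
  have hnk : n - 2 ^ k ≤ 2 ^ k := by rw [pow_succ] at hn'; lia
  rw [ballPotential, if_neg hn.not_ge]
  split_ifs with hlt
  · exact glue_add (by positivity) (pieces_compatible _
      (fun _ => ballPotential_zsmul_corner le_rfl) fun _ => ballPotential_zsmul_corner hnk) hp hpk i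
  · rw [not_lt, map_add, height_zsmul_corner] at hlt
    have hzero : ballPotential k (n - 2 ^ k) p = 0 :=
      ballPotential_eq_zero k (by split_ifs at hlt <;> lia)
    fin_cases i
    · exact absurd hlt (by simpa using hpk.trans_lt hn)
    all_goals exact hzero.symm

theorem levelForm_ballPotential_succ_of_lt {k : ℕ} {n : ℤ} (hn : 2 ^ k < n)
    (hn' : n ≤ 2 ^ (k + 1)) (h : ℤ × ℤ → ℝ) :
    levelForm (k + 1) (ballPotential (k + 1) n) h =
      levelForm k (ballPotential k (2 ^ k)) h +
        6 * (Finset.card {t ∈ cells k | height t < n - 2 ^ k} : ℝ) *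
          ∑ i, (h ((2 ^ k : ℤ) • corner i) - h 0) +
        ∑ i ∈ {1, 2}, levelForm k (ballPotential k (n - 2 ^ k))
          fun p => h (p + (2 ^ k : ℤ) • corner i) := by
  rw [levelForm_succ, Finset.sum_congr rfl fun i _ => levelForm_congr _ fun p hp hpk =>
    ballPotential_succ_add hn hn' hp hpk i]
  rw [← levelForm_harmonicExt_inflowValues k (ballPotential k (n - 2 ^ k) 0), ← levelForm_add,
    Fin.sum_univ_three, Finset.sum_pair (by decide), add_assoc]
  simp [pieces, corner]

theorem levelForm_ballPotential {k : ℕ} {n : ℤ} (hn₀ : 0 ≤ n) (hn : n ≤ 2 ^ k)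
    (h : ℤ × ℤ → ℝ) : levelForm k (ballPotential k n) h =
      2 * ∑ t ∈ cells k with height t < n, ∑ i, (h (t + corner i) - h 0) := by
  induction k generalizing n h with
  | zero =>
    have hzero : corner 0 = 0 := rfl
    rw [pow_zero] at hn
    interval_cases n
    · simp [levelForm, cells, ballPotential, height_corner, Finset.filter_singleton,
        Fin.sum_univ_three]
    · simp [levelForm, cells, ballPotential, height_corner, Finset.filter_singleton,
        Fin.sum_univ_three, hzero]
      ring
  | succ k ih =>
    rcases le_or_gt n (2 ^ k) with hnk | hnk
    · rw [levelForm_ballPotential_succ_of_le hnk, filter_cells_succ_of_le hnk, ih hn₀ hnk]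
    · have houter (i : Fin 3) : levelForm k (ballPotential k (n - 2 ^ k))
          (fun p => h (p + (2 ^ k : ℤ) • corner i)) =
            2 * ∑ t ∈ cells k with height t < n - 2 ^ k,
              ∑ j, (h (t + (2 ^ k : ℤ) • corner i + corner j) - h 0) -
            6 * (Finset.card {t ∈ cells k | height t < n - 2 ^ k} : ℝ) *
              (h ((2 ^ k : ℤ) • corner i) - h 0) := by
        rw [ih (by lia) (by rw [pow_succ] at hn; lia)]
        simp only [zero_add, Finset.sum_sub_distrib, Finset.sum_const, Finset.card_univ,
          Fintype.card_fin, nsmul_eq_mul, Nat.cast_ofNat, add_right_comm]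
        ring
      rw [levelForm_ballPotential_succ_of_lt hnk hn, sum_filter_cells_succ_of_lt hnk,
        ih (by positivity) le_rfl]
      simp only [houter, Fin.sum_univ_three, Finset.sum_pair (show (1 : Fin 3) ≠ 2 by decide)]
      simp only [corner, Fin.isValue, Matrix.cons_val_zero, add_zero, Matrix.cons_val_one,
        Matrix.cons_val, smul_zero, sub_self, Prod.smul_mk, Int.zsmul_eq_mul, mul_one,
        zero_add]
      ring

theorem sum_filter_cells_single_mul {k : ℕ} {n : ℤ} (hn : n ≤ 2 ^ k) (p : ℤ × ℤ)
    (g : ℤ × ℤ → Fin 3 → ℝ) : ∑ t ∈ cells k with height t < n,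
        ∑ i, (Pi.single p 1 : ℤ × ℤ → ℝ) (t + corner i) * g t i =
      ∑ i ∈ cornersAt p with height (p - corner i) < n, g (p - corner i) i := by
  classical
  rw [Finset.sum_comm, cornersAt, Finset.filter_filter, Finset.sum_filter]
  refine Finset.sum_congr rfl fun i _ => ?_
  have hmem : p - corner i ∈ ({t ∈ cells k | height t < n} : Finset (ℤ × ℤ)) ↔
      IsCell (p - corner i) ∧ height (p - corner i) < n := by
    rw [Finset.mem_filter, mem_cells_iff]
    exact ⟨fun h => ⟨h.1.1, h.2⟩, fun h => ⟨⟨h.1, h.2.trans_le hn⟩, h.2⟩⟩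
  simp only [Pi.single_apply, ← eq_sub_iff_add_eq, ite_mul, one_mul, zero_mul,
    Finset.sum_ite_eq', hmem]

theorem levelForm_single (k : ℕ) (f : ℤ × ℤ → ℝ) (p : ℤ × ℤ) : levelForm k f (Pi.single p 1) =
    ∑ i ∈ cornersAt p with height (p - corner i) < 2 ^ k,
      ∑ j, (f (p - corner i + corner j) - f p) := by
  have hcells : {t ∈ cells k | height t < 2 ^ k} = cells k :=
    Finset.filter_true_of_mem fun t ht => (nonneg_and_height_lt ht).2
  have hsingle := sum_filter_cells_single_mul (le_refl (2 ^ k)) p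
    fun t i => ∑ j, (f (t + corner j) - f (t + corner i))
  simpa only [levelForm, hcells, sub_add_cancel] using hsingle

theorem sum_cornersAt_ballPotential {k : ℕ} {n : ℤ} (hn₀ : 0 ≤ n) (hn : n ≤ 2 ^ k) (p : ℤ × ℤ) :
    ∑ i ∈ cornersAt p, ∑ j, (ballPotential k n (p - corner i + corner j) - ballPotential k n p) =
      2 * (Finset.card {i ∈ cornersAt p | height (p - corner i) < n} : ℝ) -
        6 * Finset.card {t ∈ cells k | height t < n} * (Pi.single p 1 : ℤ × ℤ → ℝ) 0 := by
  have hform := levelForm_ballPotential hn₀ hn (Pi.single p 1)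
  have hcount := sum_filter_cells_single_mul hn p fun _ _ => 1
  simp only [mul_one, Finset.sum_const, nsmul_eq_mul] at hcount
  rw [← hcount, ← Finset.sum_filter_of_ne (p := fun i => height (p - corner i) < 2 ^ k)
    fun i _ hi => ?_, ← levelForm_single, hform]
  · simp only [Finset.sum_sub_distrib, Finset.sum_const, Finset.card_univ, Fintype.card_fin,
      nsmul_eq_mul]
    push_cast
    ring
  · contrapose! hi
    refine Finset.sum_eq_zero fun j _ => ?_
    have hheight := height_nonneg (corner_nonneg i)
    have hheight' := height_nonneg (corner_nonneg j)
    rw [map_sub] at hi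
    rw [ballPotential_eq_zero, ballPotential_eq_zero, sub_zero]
    · lia
    · rw [map_add, map_sub]
      lia

/-! ### The odometer -/

theorem abs_units_smul (ε : ℤˣ) (p : ℤ × ℤ) : |ε • p| = |p| := by
  obtain rfl | rfl := Int.units_eq_one_or ε
  · rw [one_smul]
  · rw [Units.neg_smul, one_smul, abs_neg]

/-- The odometer of the divisible sandpile with `ballMass n` particles at the origin. -/
noncomputable def odometer (n : ℤ) (z : Vertex) : ℝ := ballPotential n.toNat n |(z : ℤ × ℤ)|

theorem le_two_pow_toNat (n : ℤ) : n ≤ 2 ^ n.toNat :=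
  n.self_le_toNat.trans (mod_cast n.toNat.lt_two_pow_self.le)

theorem height_abs_coe (z : Vertex) : height |z.1| = |height z.1| := by
  obtain ⟨ε, i, hi⟩ := mem_gasket_verts.1 z.2
  have hnonneg := nonneg_of_mem_cornersAt hi
  rw [← abs_units_smul ε, abs_of_nonneg hnonneg, ← abs_height_units_smul ε,
    abs_of_nonneg (height_nonneg hnonneg)]

theorem odometer_eq_zero {n : ℤ} {z : Vertex} (hz : n ≤ |height z.1|) : odometer n z = 0 :=
  ballPotential_eq_zero _ (by rwa [height_abs_coe])

theorem odometer_pos {n : ℤ} {z : Vertex} (hz : |height z.1| < n) : 0 < odometer n z :=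
  ballPotential_pos (le_two_pow_toNat n) (by rwa [height_abs_coe])

theorem odometer_nonneg (n : ℤ) (z : Vertex) : 0 ≤ odometer n z := by
  rcases lt_or_ge |height z.1| n with hlt | hge
  exacts [(odometer_pos hlt).le, (odometer_eq_zero hge).ge]

theorem cluster_odometer (n : ℤ) : cluster (odometer n) = ball (n - 1) := by
  ext z
  rw [mem_ball, cluster, Set.mem_ofPred_eq, Int.le_sub_one_iff]
  refine ⟨fun hpos => ?_, odometer_pos⟩
  contrapose! hpos
  exact (odometer_eq_zero hpos).le

theorem laplacian_odometer {n : ℤ} (hn : 0 ≤ n) (z : Vertex) : laplacian (odometer n) z =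
    1 / 2 * ∑ ε : ℤˣ,
        (Finset.card {i ∈ cornersAt (ε • z.1) | height (ε • z.1 - corner i) < n} : ℝ) -
      3 * Finset.card {t ∈ cells n.toNat | height t < n} * pointMass origin z := by
  have habs {ε : ℤˣ} {i : Fin 3} (hi : i ∈ cornersAt (ε • z.1)) (j : Fin 3) :
      |z.1 + ε • (corner j - corner i)| = ε • z.1 - corner i + corner j := by
    rw [← abs_units_smul ε, units_smul_add_units_smul, add_sub, add_sub_right_comm]
    exact abs_of_nonneg (add_nonneg (mem_cornersAt.1 hi).nonneg (corner_nonneg j))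
  have habs' {ε : ℤˣ} {i : Fin 3} (hi : i ∈ cornersAt (ε • z.1)) : |z.1| = ε • z.1 := by
    simpa using habs hi i
  have hsingle (ε : ℤˣ) : (Pi.single (ε • z.1) 1 : ℤ × ℤ → ℝ) 0 = pointMass origin z := by
    simp only [pointMass, Pi.single_apply, eq_comm (a := (0 : ℤ × ℤ)), units_smul_eq_zero,
      coe_eq_zero]
  have hterm (ε : ℤˣ) : ∑ i ∈ cornersAt (ε • z.1), ∑ j,
      (ballPotential n.toNat n |z.1 + ε • (corner j - corner i)| - ballPotential n.toNat n |z.1|) =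
        2 * (Finset.card {i ∈ cornersAt (ε • z.1) | height (ε • z.1 - corner i) < n} : ℝ) -
          6 * Finset.card {t ∈ cells n.toNat | height t < n} * pointMass origin z := by
    rw [← hsingle ε, ← sum_cornersAt_ballPotential hn (le_two_pow_toNat n)]
    exact Finset.sum_congr rfl fun i hi => by simp only [habs hi, habs' hi]
  rw [show odometer n = fun y : Vertex => ballPotential n.toNat n |y.1| from rfl,
    laplacian_comp_coe fun p => ballPotential n.toNat n |p|]
  simp only [hterm]
  simp only [Finset.sum_sub_distrib, ← Finset.mul_sum, Finset.sum_const, Finset.card_univ,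
    Fintype.card_units_int, nsmul_eq_mul, Nat.cast_ofNat]
  ring

theorem card_filter_cornersAt (p : ℤ × ℤ) (n : ℤ) :
    Finset.card {i ∈ cornersAt p | height (p - corner i) < n} =
      if height p < n then (cornersAt p).card
      else if height p = n then ((cornersAt p).erase 0).card else 0 := by
  simp only [map_sub, height_corner]
  split_ifs with hlt heq
  · rw [Finset.filter_true_of_mem]
    intro i _
    split_ifs <;> lia
  · congr 1
    ext i
    rw [Finset.mem_filter, Finset.mem_erase, and_comm]
    refine and_congr_left fun _ => ?_
    split_ifs with hi <;> simp [hi, heq]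
  · rw [Finset.card_eq_zero, Finset.filter_eq_empty_iff]
    intro i _
    split_ifs <;> lia

theorem finalSand_eq_sum {n : ℤ} (hn : 0 < n) (z : Vertex) : finalSand n z =
    1 / 2 * ∑ ε : ℤˣ,
      (Finset.card {i ∈ cornersAt (ε • z.1) | height (ε • z.1 - corner i) < n} : ℝ) := by
  simp only [finalSand, mem_ball, mem_innerBoundary_ball, card_filter_cornersAt]
  rcases eq_or_ne z origin with rfl | hz
  · simp [coe_origin, cornersAt_zero, hn, hn.le, hn.ne]
  obtain ⟨ε, hcard, hempty⟩ := exists_card_cornersAt_eq_two z.2 (coe_eq_zero.not.2 hz)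
  rw [← Units.neg_smul] at hempty
  obtain ⟨i, hi⟩ := Finset.card_pos.1 (hcard ▸ two_pos)
  have hheight : |height z.1| = height (ε • z.1) := by
    rw [← abs_height_units_smul ε, abs_of_nonneg (height_nonneg (nonneg_of_mem_cornersAt hi))]
  have hboundary : (∃ ε' : ℤˣ, 0 ∈ cornersAt (ε' • z.1)) ↔ 0 ∈ cornersAt (ε • z.1) := by
    refine ⟨fun ⟨ε', h₀⟩ => ?_, fun h₀ => ⟨ε, h₀⟩⟩
    rcases eq_or_ne ε' ε with rfl | hne
    · exact h₀
    · rw [Int.units_ne_iff_eq_neg.1 hne, hempty] at h₀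
      exact absurd h₀ (Finset.notMem_empty _)
  rw [sum_units_int _ ε]
  simp only [hempty, hcard, hboundary, hheight]
  clear hheight
  generalize height (ε • z.1) = m
  rcases lt_trichotomy m n with hlt | heq | hgt
  · simp [hlt, hlt.le, hlt.ne]
  · by_cases h₀ : 0 ∈ cornersAt (ε • z.1) <;> simp [heq, h₀, hcard]
  · simp [hgt.not_ge, hgt.not_gt, hgt.ne']

theorem sum_finalSand (n : ℤ) : ∑ z ∈ (finite_ball n).toFinset, finalSand n z = ballMass n := by
  classical
  have hsplit (z : Vertex) (hz : z ∈ (finite_ball n).toFinset) :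
      finalSand n z = 1 - 1 / 2 * if z ∈ innerBoundary (ball n) then 1 else 0 := by
    rw [finalSand, if_pos ((finite_ball n).mem_toFinset.1 hz)]
    split_ifs <;> norm_num
  have hboundary : (innerBoundary (ball n)).ncard =
      Finset.card {z ∈ (finite_ball n).toFinset | z ∈ innerBoundary (ball n)} := by
    rw [← Set.ncard_coe_finset]
    congr 1
    ext z
    simpa using fun h : z ∈ innerBoundary (ball n) => h.1
  rw [Finset.sum_congr rfl hsplit, Finset.sum_sub_distrib, ← Finset.mul_sum, Finset.sum_boole,
    Finset.sum_const, nsmul_one, ballMass, hboundary, Set.ncard_eq_toFinset_card _ (finite_ball n)]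

theorem sum_laplacian_odometer (n : ℤ) :
    ∑ z ∈ (finite_ball n).toFinset, laplacian (odometer n) z = 0 := by
  refine sum_laplacian_eq_zero fun z hz y hy hzy => ?_
  rw [Set.Finite.mem_toFinset, mem_ball, Int.abs_eq_natAbs] at hz hy
  have hle := natAbs_height_le_add_one hzy
  rw [odometer_eq_zero, odometer_eq_zero] <;> rw [Int.abs_eq_natAbs] <;> lia

theorem laplacian_odometer_of_nonpos {n : ℤ} (hn : n ≤ 0) (z : Vertex) :
    laplacian (odometer n) z = 0 := by
  have hzero (y : Vertex) : odometer n y = 0 := odometer_eq_zero (hn.trans (abs_nonneg _))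
  simp [laplacian_eq_sum, hzero]

theorem exists_finalSand_eq (n : ℤ) :
    ∃ c, ∀ z, finalSand n z = c * pointMass origin z + laplacian (odometer n) z := by
  rcases lt_or_ge 0 n with hn | hn
  · refine ⟨3 * Finset.card {t ∈ cells n.toNat | height t < n}, fun z => ?_⟩
    rw [finalSand_eq_sum hn, laplacian_odometer hn.le]
    ring
  · refine ⟨finalSand n origin, fun z => ?_⟩
    rw [laplacian_odometer_of_nonpos hn, add_zero]
    rcases eq_or_ne z origin with rfl | hz
    · rw [pointMass_self, mul_one]
    · obtain ⟨y, -, hy⟩ := exists_adj_natAbs_height_add_one hz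
      have hball : z ∉ ball n := by
        rw [mem_ball, Int.abs_eq_natAbs]
        lia
      simp [finalSand, pointMass, hz, hball]

theorem finalSand_eq (n : ℤ) (z : Vertex) :
    finalSand n z = ballMass n * pointMass origin z + laplacian (odometer n) z := by
  rcases lt_or_ge n 0 with hn | hn
  · have hball (y : Vertex) : y ∉ ball n := fun hy =>
      hn.not_ge ((abs_nonneg _).trans (mem_ball.1 hy))
    have hmass : ballMass n = 0 := by
      rw [← sum_finalSand]
      simp [finalSand, hball]
    simp [finalSand, hball, hmass, laplacian_odometer_of_nonpos hn.le]
  · obtain ⟨c, hc⟩ := exists_finalSand_eq n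
    have horigin : origin ∈ (finite_ball n).toFinset := by
      simpa [mem_ball, coe_origin] using hn
    have hmass : ballMass n = c := by
      rw [← sum_finalSand, Finset.sum_congr rfl fun z _ => hc z, Finset.sum_add_distrib,
        sum_laplacian_odometer, add_zero, ← Finset.mul_sum,
        Finset.sum_eq_single_of_mem origin horigin, pointMass_self, mul_one]
      exact fun y _ hy => Pi.single_eq_of_ne hy 1
    rw [hc, hmass]

theorem finalSand_le_one (n : ℤ) (z : Vertex) : finalSand n z ≤ 1 := by
  rw [finalSand]
  split_ifs <;> norm_num

theorem finalSand_eq_one {n : ℤ} {z : Vertex} (hz : z ∈ ball (n - 1)) : finalSand n z = 1 := by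
  rw [mem_ball] at hz
  rw [finalSand, if_pos (mem_ball.2 (by lia)), if_neg]
  rw [mem_innerBoundary_ball]
  lia

end GasketSandpile

theorem mainTheorem2 (n : ℤ) :
    GasketSandpile.IsLimitSand
        (fun z => GasketSandpile.ballMass n * GasketSandpile.pointMass GasketSandpile.origin z)
        (GasketSandpile.finalSand n) ∧
      ∃ u : GasketSandpile.Vertex → ℝ,
        GasketSandpile.IsOdometer
            (fun z => GasketSandpile.ballMass n * GasketSandpile.pointMass GasketSandpile.origin z)
            u ∧
          GasketSandpile.cluster u = GasketSandpile.ball (n - 1) := by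
  have hsand := GasketSandpile.finalSand_eq n
  have hcluster := GasketSandpile.cluster_odometer n
  have hodometer : GasketSandpile.IsOdometer
      (fun z => GasketSandpile.ballMass n * GasketSandpile.pointMass GasketSandpile.origin z)
      (GasketSandpile.odometer n) := by
    refine GasketSandpile.isOdometer_of_add_laplacian_eq_one (GasketSandpile.odometer_nonneg n)
      (hcluster ▸ GasketSandpile.finite_ball _)
      (fun z => hsand z ▸ GasketSandpile.finalSand_le_one n z) fun z hz => ?_
    rw [← hsand, GasketSandpile.finalSand_eq_one (hcluster ▸ hz)]
  refine ⟨?_, GasketSandpile.odometer n, hodometer, hcluster⟩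
  rw [funext hsand]
  exact hodometer.isLimitSand
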